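/- \textbf{Definitions.} For $A\in\mathbb R^{f\times c}$ and $B\in\mathbb R^{m\times n}$ let $A\otimes B\in\mathbb R^{fm\times cn}$ be the Kronecker product. Let $S\ge 1$, factor shapes $(f_1,c_1),\dots,(f_S,c_S)$ and ranks $R_1,\dots,R_{S-1}$ be nonnegative integers; call these data a \emph{SeKron architecture} of width $\prod_k f_k$ and input dimension $\prod_k c_k$. A matrix $W$ of size $\prod_k f_k\times\prod_k c_k$ is \emph{SeKron-factorized} with this architecture if $$W=\sum_{r_1=1}^{R_1}A^{(1)}_{r_1}\otimes\Big(\sum_{r_2=1}^{R_2}A^{(2)}_{r_1r_2}\otimes\cdots\otimes\Big(\sum_{r_{S-1}=1}^{R_{S-1}}A^{(S-1)}_{r_1\cdots r_{S-1}}\otimes A^{(S)}_{r_1\cdots r_{S-1}}\Big)\cdots\Big)$$ with $A^{(k)}_{\cdots}\in\mathbb R^{f_k\times c_k}$ (for $S=1$, $W=A^{(1)}$ is an arbitrary $f_1\times c_1$ matrix). The architecture is \emph{of full rank} if $R_k\ge\min\big(f_kc_k,\ \prod_{l>k}f_lc_l\big)$ for $1\le k\le S-1$. A \emph{shallow SeKron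 network} with activation $a:\mathbb R\to\mathbb R$ and this architecture is a function $\mathbb R^d\to\mathbb R$, $x\mapsto w^{\top}a(Wx+b)$, where $d=\prod_k c_k$, $m=\prod_k f_k$, $W\in\mathbb R^{m\times d}$ is SeKron-factorized with this architecture, $b,w\in\mathbb R^m$ are arbitrary, and $a$ acts coordinatewise. \textbf{Theorem (universal approximation via shallow SeKron networks).} Let $a:\mathbb R\to\mathbb R$ be $L$-Lipschitz and not a polynomial function, let $d\ge 0$, and let $X\subset\mathbb R^d$ be compact. (i) For every $S\ge1$ and all $c_1,\dots,c_S$ with $c_1\cdots c_S=d$, the set of restrictions to $X$ of the shallow SeKron networks with activation $a$ and $S$ factors having $c_1,\dots,c_S$ columns (with arbitrary ranks and arbitrary row numbers $f_1,\dots,f_S$) is dense in $C(X)$ for the uniform norm. (ii) More generally, let $\mathcal D$ be any set of SeKron architectures that contains full-rank architectures of input dimension $d$ and arbitrarily large width. Then the set of restrictions to $X$ of the shallow SeKron networks with activation $a$ and architecture in $\mathcal D$ is dense in $C(X)$ for the uniform norm. -/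

import Mathlib

open scoped NNReal Matrix Polynomial

noncomputable section

/-- The Kronecker product of an `f × c` and an `m × n` matrix as an `(f * m) × (c * n)` matrix:
entry `(i, j)` is `A (i / m) (j / n) * B (i % m) (j % n)`. -/
def kron {f c m n : ℕ} (A : Matrix (Fin f) (Fin c) ℝ) (B : Matrix (Fin m) (Fin n) ℝ) :
    Matrix (Fin (f * m)) (Fin (c * n)) ℝ :=
  Matrix.reindex finProdFinEquiv finProdFinEquiv (Matrix.kronecker A B)

theorem kron_apply {f c m n : ℕ} (A : Matrix (Fin f) (Fin c) ℝ) (B : Matrix (Fin m) (Fin n) ℝ)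
    (i : Fin (f * m)) (j : Fin (c * n)) :
    kron A B i j = A i.divNat j.divNat * B i.modNat j.modNat := rfl

/-- `IsSeKron ranks rows cols W` : the matrix `W` is a sum of sequences of Kronecker products
`W = ∑_{r₁ < R₁} A_{r₁} ⊗ ∑_{r₂ < R₂} A_{r₁ r₂} ⊗ ⋯ ⊗ ∑_{r_{S-1} < R_{S-1}} A_{r₁ ⋯ r_{S-1}} ⊗ A'_{r₁ ⋯ r_{S-1}}`
with ranks `ranks = [R₁, …, R_{S-1}]`, where the `k`-th factors (the `A_{r₁ ⋯ r_k}` for `k < S`,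
the `A'_{r₁ ⋯ r_{S-1}}` for `k = S`) are `rows[k] × cols[k]` matrices.
(For one factor, `S = 1`, `ranks` is empty and `W` is an arbitrary matrix.) -/
inductive IsSeKron : List ℕ → List ℕ → List ℕ →
    {m n : ℕ} → Matrix (Fin m) (Fin n) ℝ → Prop
  | last {f c : ℕ} (A : Matrix (Fin f) (Fin c) ℝ) : IsSeKron [] [f] [c] A
  | step {ranks rows cols : List ℕ} {R f c m n : ℕ} (hm : m = rows.prod) (hn : n = cols.prod)
      (A : Fin R → Matrix (Fin f) (Fin c) ℝ) (B : Fin R → Matrix (Fin m) (Fin n) ℝ)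
      (hB : ∀ r, IsSeKron ranks rows cols (B r)) :
      IsSeKron (R :: ranks) (f :: rows) (c :: cols) (∑ r, kron (A r) (B r))

/-- The ranks `[R₁, …, R_{S-1}]` and the shapes `rows[k] × cols[k]`, `1 ≤ k ≤ S`, of the factors
of a SeKron factorization. -/
structure SeKronArch where
  ranks : List ℕ
  rows : List ℕ
  cols : List ℕ

/-- The lengths of the three lists fit together, and nothing is truncated: each rank `R_k` is at
least the smaller one of the number of entries of the `k`-th factor and the number of entries of
the Kronecker product of the later factors. -/
def IsFullRank : List ℕ → List ℕ → List ℕ → Prop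
  | [], [_], [_] => True
  | R :: ranks, f :: rows, c :: cols =>
      min (f * c) (rows.prod * cols.prod) ≤ R ∧ IsFullRank ranks rows cols
  | _, _, _ => False

/-- The shallow network `x ↦ wᵀ a(W x + b)`, with `a` acting coordinatewise. -/
def shallowNet (a : ℝ → ℝ) {m d : ℕ} (W : Matrix (Fin m) (Fin d) ℝ) (b w : Fin m → ℝ)
    (x : Fin d → ℝ) : ℝ :=
  ∑ i, w i * a ((W *ᵥ x) i + b i)

/-- The restrictions to `X` of the shallow networks with activation `a` whose weight matrix is
SeKron-factorized with ranks and shapes from the set `𝓓`. -/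
def seKronNetworks (a : ℝ → ℝ) {d : ℕ} (X : Set (Fin d → ℝ)) (𝓓 : Set SeKronArch) :
    Set C(X, ℝ) :=
  {g | ∃ D ∈ 𝓓, ∃ (m : ℕ) (W : Matrix (Fin m) (Fin d) ℝ) (b w : Fin m → ℝ),
    IsSeKron D.ranks D.rows D.cols W ∧ ∀ x : X, g x = shallowNet a W b w x}

end

/-! Let M be the closed span of the functions a(⟨u,x⟩ + b). For a linear form p, integrating a(lp +
b) over a window of length h in b and differentiating in l puts p · (Δ_h a)(lp + b) in M, so a need
not be smooth. Iterating (`mul_ridge_contFwdDiff_mem`) and setting l = 0 gives p^n ∈ M as soon as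
Δ_h^n a is nonzero somewhere. It is: Δ_h a is bounded by L|h|, so if Δ_h^n a vanished for all h,
then Δ_h² a would too, making a affine. Hence exp p ∈ M, and Stone–Weierstrass gives M = C(X). Full
rank makes the SeKron constraint vacuous, by expansion in matrix units (`exists_eq_sum_kron`), and
spare width is filled with idle neurons. -/

/-- A bounded function with vanishing second differences has vanishing first differences. -/
theorem fwdDiff_eq_zero_of_bounded {h C : ℝ} {u : ℝ → ℝ} (hC : ∀ t, |u t| ≤ C)
    (hu : ∀ t, fwdDiff h (fwdDiff h u) t = 0) (t : ℝ) : fwdDiff h u t = 0 := by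
  have hstep : ∀ n : ℕ, fwdDiff h u (t + n * h) = fwdDiff h u t := by
    intro n
    induction n with
    | zero => simp
    | succ n ih =>
      rw [← ih, ← sub_eq_zero, ← hu (t + n * h)]
      simp only [fwdDiff]
      push_cast
      ring_nf
  have hlin : ∀ n : ℕ, u (t + n * h) = u t + n * fwdDiff h u t := by
    intro n
    induction n with
    | zero => simp
    | succ n ih =>
      have := hstep n
      have h2 : t + ((n + 1 : ℕ) : ℝ) * h = t + n * h + h := by push_cast; ring
      rw [h2]
      simp only [fwdDiff] at this ih ⊢
      push_cast
      linarith
  by_contra hne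
  -- Linear growth along t + n * h beats the maximal oscillation 2 * C.
  obtain ⟨n, hn⟩ := exists_nat_gt (2 * C / |fwdDiff h u t|)
  rw [div_lt_iff₀ (abs_pos.mpr hne)] at hn
  have h1 : (n : ℝ) * |fwdDiff h u t| = |u (t + n * h) - u t| := by
    rw [hlin n, add_sub_cancel_left, abs_mul, Nat.abs_cast]
  have h2 := abs_sub (u (t + n * h)) (u t)
  linarith [hC (t + n * h), hC t]

theorem exists_abs_fwdDiff_iterate_le {h C : ℝ} {u : ℝ → ℝ} (hC : ∀ t, |u t| ≤ C) (n : ℕ) :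
    ∃ C', ∀ t, |(fwdDiff h)^[n] u t| ≤ C' := by
  induction n with
  | zero => exact ⟨C, hC⟩
  | succ n ih =>
    obtain ⟨C', hC'⟩ := ih
    refine ⟨C' + C', fun t => ?_⟩
    rw [Function.iterate_succ_apply']
    exact (abs_sub _ _).trans (add_le_add (hC' _) (hC' _))

/-- All differences of u are bounded, so the bounded case lowers the vanishing order one step at a
time. -/
theorem fwdDiff_eq_zero_of_iterate_eq_zero {h C : ℝ} {u : ℝ → ℝ} (hC : ∀ t, |u t| ≤ C) (n : ℕ)
    (hu : ∀ t, (fwdDiff h)^[n + 1] u t = 0) (t : ℝ) : fwdDiff h u t = 0 := by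
  induction n generalizing t with
  | zero => exact hu t
  | succ n ih =>
    refine ih (fun t => ?_) t
    obtain ⟨C', hC'⟩ := exists_abs_fwdDiff_iterate_le (h := h) hC n
    rw [Function.iterate_succ_apply']
    refine fwdDiff_eq_zero_of_bounded hC' (fun t => ?_) t
    rw [← Function.iterate_succ_apply' (fwdDiff h), ← Function.iterate_succ_apply' (fwdDiff h)]
    exact hu t

/-- A continuous function all of whose second differences vanish is affine. -/
theorem exists_eq_affine_of_fwdDiff_fwdDiff_eq_zero {a : ℝ → ℝ} (ha : Continuous a)
    (h2 : ∀ h t, fwdDiff h (fwdDiff h a) t = 0) : ∃ c, ∀ t, a t = c * t + a 0 := by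
  -- Midpoint affinity makes a - a 0 additive, and continuous additive maps are linear.
  have hmid : ∀ x y, 2 * a ((x + y) / 2) = a x + a y := by
    intro x y
    have := h2 ((y - x) / 2) x
    simp only [fwdDiff] at this
    rw [show x + (y - x) / 2 + (y - x) / 2 = y by ring,
      show x + (y - x) / 2 = (x + y) / 2 by ring] at this
    linarith
  let f : ℝ →+ ℝ :=
    { toFun := fun t => a t - a 0
      map_zero' := sub_self _
      map_add' := fun x y => by
        have h1 := hmid x y
        have h3 := hmid (x + y) 0
        rw [add_zero] at h3
        linarith }
  have hf : Continuous f := ha.sub continuous_const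
  refine ⟨f 1, fun t => ?_⟩
  have h1 := map_real_smul f hf t 1
  simp only [smul_eq_mul, mul_one] at h1
  have h3 : f t = a t - a 0 := rfl
  linarith

/-- A Lipschitz function that is not a polynomial has non-vanishing differences of every order. -/
theorem exists_fwdDiff_iterate_ne_zero {a : ℝ → ℝ} {L : ℝ≥0} (ha : LipschitzWith L a)
    (hpoly : ¬ ∃ p : ℝ[X], ∀ t, a t = p.eval t) (n : ℕ) :
    ∃ h b, (fwdDiff h)^[n] a b ≠ 0 := by
  by_contra! H
  refine hpoly ?_
  have h2 : ∀ h t, fwdDiff h (fwdDiff h a) t = 0 := by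
    intro h t
    refine fwdDiff_eq_zero_of_iterate_eq_zero (C := L * |h|) (fun t => ?_) n (fun t => ?_) t
    · have := ha.dist_le_mul (t + h) t
      simpa [Real.dist_eq, fwdDiff] using this
    · have h0 : (fwdDiff h)^[n] a = 0 := funext (H h)
      rw [← Function.iterate_succ_apply, Function.iterate_succ_apply',
        Function.iterate_succ_apply', h0]
      simp [fwdDiff]
  obtain ⟨c, hc⟩ := exists_eq_affine_of_fwdDiff_fwdDiff_eq_zero ha.continuous h2
  exact ⟨.C c * .X + .C (a 0), fun t => by simp [hc t]⟩

/-! ### Integrals, derivatives and ridge functions in closed subspaces -/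

theorem Submodule.intervalIntegral_mem {E : Type*} [NormedAddCommGroup E] [NormedSpace ℝ E]
    [CompleteSpace E] {M : Submodule ℝ E} (hM : IsClosed (M : Set E)) {F : ℝ → E}
    (hF : Continuous F) (hFM : ∀ s, F s ∈ M) (u v : ℝ) : ∫ s in u..v, F s ∈ M := by
  have : CompleteSpace M := hM.completeSpace_coe
  let G : ℝ → M := fun s => ⟨F s, hFM s⟩
  have hG : Continuous G := hF.subtype_mk _
  have h := M.subtypeL.intervalIntegral_comp_comm 
    (hG.intervalIntegrable (μ := MeasureTheory.volume) u v)
  exact h ▸ (∫ s in u..v, G s : M).2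

theorem Submodule.deriv_mem {E : Type*} [NormedAddCommGroup E] [NormedSpace ℝ E]
    {M : Submodule ℝ E} (hM : IsClosed (M : Set E)) {F : ℝ → E} {F' : E} {t : ℝ}
    (hF : HasDerivAt F F' t) (hFM : ∀ s, F s ∈ M) : F' ∈ M :=
  hM.mem_of_tendsto hF.tendsto_slope
    (.of_forall fun _ => M.smul_mem _ (M.sub_mem (hFM _) (hFM _)))

section Ridge

variable {Y : Type*} [TopologicalSpace Y] [CompactSpace Y]

theorem ContinuousMap.intervalIntegral_apply {F : ℝ → C(Y, ℝ)} (hF : Continuous F) (u v : ℝ)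
    (y : Y) : (∫ s in u..v, F s) y = ∫ s in u..v, F s y :=
  ((ContinuousMap.evalCLM ℝ y).intervalIntegral_comp_comm (hF.intervalIntegrable u v)).symm

/-- The function `y ↦ g (l * p y + b)`. -/
def ridge (g : C(ℝ, ℝ)) (p : C(Y, ℝ)) (l b : ℝ) : C(Y, ℝ) :=
  g.comp (l • p + .const Y b)

omit [CompactSpace Y] in
@[simp]
theorem ridge_apply (g : C(ℝ, ℝ)) (p : C(Y, ℝ)) (l b : ℝ) (y : Y) :
    ridge g p l b y = g (l * p y + b) := rfl

theorem Continuous.ridge {Z : Type*} [TopologicalSpace Z] (g : C(ℝ, ℝ)) (p : C(Y, ℝ))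
    {l b : Z → ℝ} (hl : Continuous l) (hb : Continuous b) :
    Continuous fun z => ridge g p (l z) (b z) :=
  (ContinuousMap.continuous_postcomp g).comp
    ((hl.smul continuous_const).add (ContinuousMap.continuous_const'.comp hb))

/-- The forward difference of a continuous function. -/
def contFwdDiff (h : ℝ) (g : C(ℝ, ℝ)) : C(ℝ, ℝ) :=
  ⟨fwdDiff h g, (g.continuous.comp (continuous_add_const h)).sub g.continuous⟩

theorem coe_contFwdDiff_iterate (h : ℝ) (g : C(ℝ, ℝ)) (n : ℕ) :
    ⇑((contFwdDiff h)^[n] g) = (fwdDiff h)^[n] g := by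
  induction n with
  | zero => rfl
  | succ n ih => rw [Function.iterate_succ_apply', Function.iterate_succ_apply', ← ih]; rfl

/-- The integral of `g` over `[t, t + h]` has derivative `g (t + h) - g t`; differentiate
`l ↦ q * ∫ s in 0..h, g (l * p + b + s)` under the integral. -/
theorem mul_ridge_contFwdDiff_mem {M : Submodule ℝ C(Y, ℝ)} (hM : IsClosed (M : Set C(Y, ℝ)))
    {p q : C(Y, ℝ)} {g : C(ℝ, ℝ)} (hg : ∀ l b, q * ridge g p l b ∈ M) (h l b : ℝ) :
    q * p * ridge (contFwdDiff h g) p l b ∈ M := by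
  let K : ℝ → C(Y, ℝ) := fun s => q * p * ridge (contFwdDiff h g) p s b
  have hK : Continuous K := continuous_const.mul (.ridge _ _ continuous_id continuous_const)
  let I : ℝ → C(Y, ℝ) := fun l => ∫ s in 0..h, q * ridge g p l (b + s)
  have hIc : ∀ l, Continuous fun s => q * ridge g p l (b + s) := fun l =>
    continuous_const.mul (.ridge _ _ continuous_const (continuous_const.add continuous_id))
  have hI : ∀ l, I l ∈ M := fun l =>
    Submodule.intervalIntegral_mem hM (hIc l) (fun s => hg _ _) _ _
  have key : ∀ l, ∫ s in 0..l, K s = I l - I 0 := by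
    intro l
    ext y
    have gi : ∀ u v, IntervalIntegrable g MeasureTheory.volume u v :=
      g.continuous.intervalIntegrable
    -- Keeping the factor p y on the left covers p y = 0 as well.
    have e1 : ∀ c, p y * ∫ s in 0..l, g (c + p y * s) = ∫ s in c..c + p y * l, g s := fun c => by
      simp
    have e2 : ∀ l, ∫ s in 0..h, g (l * p y + (b + s)) =
        ∫ s in l * p y + b..l * p y + b + h, g s := fun l => by
      have := intervalIntegral.integral_comp_add_left (f := g) (a := 0) (b := h) (l * p y + b)
      simpa [add_assoc] using this
    have gc : ∀ c, Continuous fun s => g (c + p y * s) := fun c =>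
      g.continuous.comp (by fun_prop)
    have e3 : ∀ s, K s y = q y * (p y * (g (b + h + p y * s) - g (b + p y * s))) := fun s => by
      change q y * p y * (g (s * p y + b + h) - g (s * p y + b)) = _
      ring_nf
    rw [ContinuousMap.intervalIntegral_apply hK, ContinuousMap.sub_apply,
      ContinuousMap.intervalIntegral_apply (hIc l), ContinuousMap.intervalIntegral_apply (hIc 0)]
    simp only [e3, ContinuousMap.mul_apply, ridge_apply, intervalIntegral.integral_const_mul, e2]
    rw [intervalIntegral.integral_sub ((gc _).intervalIntegrable _ _)
      ((gc _).intervalIntegrable _ _), mul_sub (p y), e1, e1, ← mul_sub,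
      intervalIntegral.integral_interval_sub_interval_comm (gi _ _) (gi _ _) (gi _ _)]
    rw [intervalIntegral.integral_symm b, intervalIntegral.integral_symm (b + p y * l)]
    ring_nf
  have hd : HasDerivAt (fun l => ∫ s in 0..l, K s) (K l) l :=
    (hK.integral_hasStrictDerivAt 0 l).hasDerivAt
  exact Submodule.deriv_mem hM hd fun l => key l ▸ M.sub_mem (hI _) (hI _)

/-- If all differences of `g` are nonzero somewhere, a closed subspace that contains all
`g (l * p + b)` contains the powers of `p`. -/
theorem pow_mem_of_ridge_mem {M : Submodule ℝ C(Y, ℝ)} (hM : IsClosed (M : Set C(Y, ℝ)))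
    {p : C(Y, ℝ)} {g : C(ℝ, ℝ)} (hg : ∀ l b, ridge g p l b ∈ M) {n : ℕ} {h b : ℝ}
    (hb : (fwdDiff h)^[n] g b ≠ 0) : p ^ n ∈ M := by
  have H : ∀ n : ℕ, ∀ l b, p ^ n * ridge ((contFwdDiff h)^[n] g) p l b ∈ M := by
    intro n
    induction n with
    | zero => simpa using hg
    | succ n ih =>
      intro l b
      rw [pow_succ, Function.iterate_succ_apply']
      exact mul_ridge_contFwdDiff_mem hM ih h l b
  rw [← coe_contFwdDiff_iterate] at hb
  -- At l = 0 the ridge factor is a nonzero constant, which is divided out.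
  have h1 := M.smul_mem ((contFwdDiff h)^[n] g b)⁻¹ (H n 0 b)
  convert h1 using 1
  ext y
  simp only [ContinuousMap.smul_apply, ContinuousMap.mul_apply, ridge_apply, zero_mul, zero_add,
    smul_eq_mul]
  field_simp

theorem exp_apply (p : C(Y, ℝ)) (y : Y) : NormedSpace.exp p y = Real.exp (p y) := by
  have h1 := (NormedSpace.exp_series_hasSum_exp' (𝕂 := ℝ) p).map (ContinuousMap.evalCLM ℝ y)
    (ContinuousMap.evalCLM ℝ y).continuous
  rw [Real.exp_eq_exp_ℝ]
  exact h1.unique (NormedSpace.exp_series_hasSum_exp' (𝕂 := ℝ) (p y))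

theorem exp_mem_of_pow_mem {M : Submodule ℝ C(Y, ℝ)} (hM : IsClosed (M : Set C(Y, ℝ)))
    {p : C(Y, ℝ)} (hp : ∀ n : ℕ, p ^ n ∈ M) : NormedSpace.exp p ∈ M :=
  hM.mem_of_tendsto (NormedSpace.exp_series_hasSum_exp' (𝕂 := ℝ) p)
    (.of_forall fun _ => M.sum_mem fun _ _ => M.smul_mem _ (hp _))

/-- The exponentials of the elements of a point-separating subspace span a dense subspace. -/
theorem eq_top_of_exp_mem {M : Submodule ℝ C(Y, ℝ)} (hM : IsClosed (M : Set C(Y, ℝ)))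
    (P : AddSubmonoid C(Y, ℝ)) (hsep : ∀ x y : Y, x ≠ y → ∃ p ∈ P, p x ≠ p y)
    (hP : ∀ p ∈ P, NormedSpace.exp p ∈ M) : M = ⊤ := by
  have hadd : ∀ p q : C(Y, ℝ), NormedSpace.exp (p + q) = NormedSpace.exp p * NormedSpace.exp q :=
    fun p q => by ext y; simp [exp_apply, Real.exp_add]
  -- The exponentials are closed under products, so their span is already the algebra they generate.
  let S : Submonoid C(Y, ℝ) :=
    { carrier := NormedSpace.exp '' P
      one_mem' := ⟨0, P.zero_mem, by simp⟩
      mul_mem' := by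
        rintro _ _ ⟨p, hp, rfl⟩ ⟨q, hq, rfl⟩
        exact ⟨p + q, P.add_mem hp hq, hadd p q⟩ }
  let A : Subalgebra ℝ C(Y, ℝ) := Algebra.adjoin ℝ (S : Set C(Y, ℝ))
  have hAM : Subalgebra.toSubmodule A ≤ M := by
    rw [Algebra.adjoin_eq_span_of_subset]
    · refine Submodule.span_le.mpr ?_
      rintro _ ⟨p, hp, rfl⟩
      exact hP p hp
    · rw [Submonoid.closure_eq]
      exact Submodule.subset_span
  have hA : A.SeparatesPoints := by
    intro x y hxy
    obtain ⟨p, hp, hne⟩ := hsep x y hxy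
    refine ⟨_, ⟨NormedSpace.exp p, Algebra.subset_adjoin ⟨p, hp, rfl⟩, rfl⟩, ?_⟩
    simpa [exp_apply] using hne
  refine eq_top_iff.mpr fun f _ => ?_
  have hf := ContinuousMap.continuousMap_mem_subalgebra_closure_of_separatesPoints A hA f
  exact closure_minimal (fun _ hg => hAM hg) hM hf

end Ridge

/-! ### Full-rank Kronecker factorizations -/

theorem exists_sum_kron_of_card_le {f c m n R : ℕ} {ι : Type*} [Fintype ι]
    (hR : Fintype.card ι ≤ R) (A : ι → Matrix (Fin f) (Fin c) ℝ)
    (B : ι → Matrix (Fin m) (Fin n) ℝ) :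
    ∃ (A' : Fin R → Matrix (Fin f) (Fin c) ℝ) (B' : Fin R → Matrix (Fin m) (Fin n) ℝ),
      ∑ i, kron (A i) (B i) = ∑ r, kron (A' r) (B' r) := by
  obtain ⟨e⟩ := Function.Embedding.nonempty_of_card_le (α := ι) (β := Fin R) (by simpa using hR)
  refine ⟨Function.extend e A 0, Function.extend e B 0,
    Fintype.sum_of_injective e e.injective _ _ (fun r hr => ?_) fun i => ?_⟩
  · rw [Function.extend_apply' _ _ _ hr]
    ext i j
    simp [kron_apply]
  · rw [e.injective.extend_apply, e.injective.extend_apply]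

/-- A matrix is a sum of as many Kronecker products as the smaller one of the two factor shapes has
entries. -/
theorem exists_eq_sum_kron {f c m n R : ℕ} (hR : min (f * c) (m * n) ≤ R)
    (W : Matrix (Fin (f * m)) (Fin (c * n)) ℝ) :
    ∃ (A : Fin R → Matrix (Fin f) (Fin c) ℝ) (B : Fin R → Matrix (Fin m) (Fin n) ℝ),
      W = ∑ r, kron (A r) (B r) := by
  have hrow : ∀ x : Fin (f * m), finProdFinEquiv (x.divNat, x.modNat) = x :=
    finProdFinEquiv.apply_symm_apply
  have hcol : ∀ y : Fin (c * n), finProdFinEquiv (y.divNat, y.modNat) = y :=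
    finProdFinEquiv.apply_symm_apply
  rcases min_le_iff.mp hR with h | h
  -- Block decomposition: matrix units on the left, the blocks of W on the right. The other case
  -- swaps the roles.
  · obtain ⟨A, B, hAB⟩ := exists_sum_kron_of_card_le (ι := Fin f × Fin c) (R := R) (by simpa using h)
      (fun t => Matrix.single t.1 t.2 1)
      (fun t => Matrix.of fun k l => W (finProdFinEquiv (t.1, k)) (finProdFinEquiv (t.2, l)))
    refine ⟨A, B, hAB ▸ ?_⟩
    ext x y
    rw [Matrix.sum_apply, Finset.sum_eq_single (x.divNat, y.divNat)]
    · simp [kron_apply, hrow, hcol]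
    · rintro ⟨i, j⟩ - hne
      rw [kron_apply, Matrix.single_apply_of_ne, zero_mul]
      rintro ⟨rfl, rfl⟩
      exact hne rfl
    · simp
  · obtain ⟨A, B, hAB⟩ := exists_sum_kron_of_card_le (ι := Fin m × Fin n) (R := R) (by simpa using h)
      (fun t => Matrix.of fun i j => W (finProdFinEquiv (i, t.1)) (finProdFinEquiv (j, t.2)))
      (fun t => Matrix.single t.1 t.2 1)
    refine ⟨A, B, hAB ▸ ?_⟩
    ext x y
    rw [Matrix.sum_apply, Finset.sum_eq_single (x.modNat, y.modNat)]
    · simp [kron_apply, hrow, hcol]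
    · rintro ⟨i, j⟩ - hne
      rw [kron_apply, Matrix.single_apply_of_ne, mul_zero]
      rintro ⟨rfl, rfl⟩
      exact hne rfl
    · simp

/-- With full rank, every matrix is SeKron-factorized. -/
theorem IsFullRank.isSeKron : ∀ {ranks rows cols : List ℕ}, IsFullRank ranks rows cols →
    ∀ {m n : ℕ}, m = rows.prod → n = cols.prod → ∀ W : Matrix (Fin m) (Fin n) ℝ,
      IsSeKron ranks rows cols W
  | [], [f], [c], _, m, n, hm, hn, W => by
    rw [List.prod_singleton] at hm hn
    subst hm hn
    exact .last W
  | R :: ranks, f :: rows, c :: cols, h, m, n, hm, hn, W => by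
    rw [List.prod_cons] at hm hn
    subst hm hn
    unfold IsFullRank at h
    obtain ⟨A, B, rfl⟩ := exists_eq_sum_kron h.1 W
    exact .step rfl rfl A B fun r => h.2.isSeKron rfl rfl (B r)
  | [], [], _, h, _, _, _, _, _ => by simp [IsFullRank] at h
  | [], [_], [], h, _, _, _, _, _ => by simp [IsFullRank] at h
  | [], [_], _ :: _ :: _, h, _, _, _, _, _ => by simp [IsFullRank] at h
  | [], _ :: _ :: _, _, h, _, _, _, _, _ => by simp [IsFullRank] at h
  | _ :: _, [], _, h, _, _, _, _, _ => by simp [IsFullRank] at h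
  | _ :: _, _ :: _, [], h, _, _, _, _, _ => by simp [IsFullRank] at h

/-- Any column numbers and any width occur in a full-rank architecture. -/
theorem exists_isFullRank (N : ℕ) {cols : List ℕ} (hcols : cols ≠ []) :
    ∃ ranks rows, rows.prod = N ∧ IsFullRank ranks rows cols := by
  induction cols generalizing N with
  | nil => exact absurd rfl hcols
  | cons c cols ih =>
    rcases eq_or_ne cols [] with rfl | hne
    · exact ⟨[], [N], by simp, trivial⟩
    · obtain ⟨ranks, rows, hrows, hfull⟩ := ih N hne
      -- The last factor carries all N rows; every earlier one has a single row.
      refine ⟨min (1 * c) (rows.prod * cols.prod) :: ranks, 1 :: rows, by simp [hrows], ?_⟩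
      unfold IsFullRank
      exact ⟨le_rfl, hfull⟩

/-! ### Density of shallow networks -/

section Approximation

variable {d : ℕ}

/-- The linear form `x ↦ ⟨u, x⟩` on `X`. -/
def linearForm (X : Set (Fin d → ℝ)) (u : Fin d → ℝ) : C(X, ℝ) :=
  ⟨fun x => u ⬝ᵥ x, continuous_const.dotProduct continuous_subtype_val⟩

/-- **Universal approximation**: the functions `x ↦ a (⟨u, x⟩ + b)` span a dense subspace. -/
theorem topologicalClosure_span_ridge_eq_top {a : ℝ → ℝ} {L : ℝ≥0} (ha : LipschitzWith L a)
    (hpoly : ¬ ∃ p : ℝ[X], ∀ t, a t = p.eval t) (X : Set (Fin d → ℝ)) [CompactSpace X] :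
    (Submodule.span ℝ (Set.range fun t : (Fin d → ℝ) × ℝ =>
      ridge ⟨a, ha.continuous⟩ (linearForm X t.1) 1 t.2)).topologicalClosure = ⊤ := by
  set M := Submodule.span ℝ (Set.range fun t : (Fin d → ℝ) × ℝ =>
    ridge ⟨a, ha.continuous⟩ (linearForm X t.1) 1 t.2)
  have hM : IsClosed (M.topologicalClosure : Set C(X, ℝ)) := M.isClosed_topologicalClosure
  let P : AddSubmonoid C(X, ℝ) :=
    { carrier := Set.range (linearForm X)
      zero_mem' := ⟨0, by ext x; simp [linearForm]⟩
      add_mem' := by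
        rintro _ _ ⟨u, rfl⟩ ⟨v, rfl⟩
        exact ⟨u + v, by ext x; simp [linearForm, add_dotProduct]⟩ }
  refine eq_top_of_exp_mem hM P (fun x y hxy => ?_) ?_
  · obtain ⟨i, hi⟩ := Function.ne_iff.mp (Subtype.coe_ne_coe.mpr hxy)
    exact ⟨_, ⟨Pi.single i 1, rfl⟩, by simpa [linearForm] using hi⟩
  · rintro _ ⟨u, rfl⟩
    refine exp_mem_of_pow_mem hM fun n => ?_
    obtain ⟨h, b, hb⟩ := exists_fwdDiff_iterate_ne_zero ha hpoly n
    refine pow_mem_of_ridge_mem (g := ⟨a, ha.continuous⟩) hM (fun l b => ?_) hb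
    -- The scale l is absorbed into the direction u.
    refine M.le_topologicalClosure (Submodule.subset_span ⟨(l • u, b), ?_⟩)
    ext x
    simp [linearForm, smul_dotProduct]

/-- A linear combination of `n` ridge functions is a shallow network of each width `m ≥ n`. -/
theorem exists_eq_shallowNet {a : ℝ → ℝ} {n m : ℕ} (hnm : n ≤ m) (u : Fin n → Fin d → ℝ)
    (b w : Fin n → ℝ) : ∃ (W : Matrix (Fin m) (Fin d) ℝ) (b' w' : Fin m → ℝ),
      ∀ x, ∑ i, w i * a (u i ⬝ᵥ x + b i) = shallowNet a W b' w' x := by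
  obtain ⟨k, rfl⟩ := Nat.exists_eq_add_of_le hnm
  refine ⟨Matrix.of (Fin.append u 0), Fin.append b 0, Fin.append w 0, fun x => ?_⟩
  simp [shallowNet, Fin.sum_univ_add, Matrix.mulVec]

/-- The set of networks need not be a subspace, but it contains the dense span: a combination of n
ridge functions fits into a full-rank architecture of width at least n. -/
theorem dense_seKronNetworks {a : ℝ → ℝ} {L : ℝ≥0} (ha : LipschitzWith L a)
    (hpoly : ¬ ∃ p : ℝ[X], ∀ t, a t = p.eval t) {X : Set (Fin d → ℝ)} (hX : IsCompact X)
    {𝓓 : Set SeKronArch} (h𝓓 : ∀ N : ℕ, ∃ D ∈ 𝓓, D.cols.prod = d ∧ N ≤ D.rows.prod ∧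
      IsFullRank D.ranks D.rows D.cols) :
    Dense (seKronNetworks a X 𝓓) := by
  have : CompactSpace X := isCompact_iff_compactSpace.mp hX
  have hdense := Submodule.dense_iff_topologicalClosure_eq_top.mpr
    (topologicalClosure_span_ridge_eq_top ha hpoly X)
  refine hdense.mono fun g hg => ?_
  obtain ⟨n, w, v, rfl⟩ := Submodule.mem_span_set'.mp hg
  choose t ht using fun i => (v i).2
  obtain ⟨D, hD, hcols, hrows, hfull⟩ := h𝓓 n
  obtain ⟨W, b', w', hW⟩ := exists_eq_shallowNet (a := a) hrows (fun i => (t i).1)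
    (fun i => (t i).2) w
  refine ⟨D, hD, _, W, b', w', hfull.isSeKron rfl hcols.symm W, fun x => ?_⟩
  rw [← hW]
  simp [← ht, linearForm, ContinuousMap.sum_apply]

end Approximation

theorem mainTheorem4 (a : ℝ → ℝ) (L : ℝ≥0) (ha : LipschitzWith L a)
    (hpoly : ¬ ∃ p : ℝ[X], ∀ t, a t = p.eval t)
    (d : ℕ) (X : Set (Fin d → ℝ)) (hX : IsCompact X) :
    (∀ cols : List ℕ, cols ≠ [] → cols.prod = d →
      Dense (seKronNetworks a X {D | D.cols = cols})) ∧
    (∀ 𝓓 : Set SeKronArch,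
      (∀ N : ℕ, ∃ D ∈ 𝓓, D.cols.prod = d ∧ N ≤ D.rows.prod ∧
        IsFullRank D.ranks D.rows D.cols) →
      Dense (seKronNetworks a X 𝓓)) := by
  refine ⟨fun cols hne hcols => dense_seKronNetworks ha hpoly hX fun N => ?_,
    fun 𝓓 h𝓓 => dense_seKronNetworks ha hpoly hX h𝓓⟩
  obtain ⟨ranks, rows, hrows, hfull⟩ := exists_isFullRank N hne
  exact ⟨⟨ranks, rows, cols⟩, rfl, hcols, hrows.ge, hfull⟩
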